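/- \textbf{Autoduality of the Meixner symmetric functions.} Let $\mathbb Y$ be the set of all Young diagrams (partitions) $\lambda=(\lambda_1\ge\lambda_2\ge\dots)$; write $|\lambda|$ for the number of boxes and $\ell(\lambda)$ for the number of nonzero rows. The content of the box $\square=(i,j)$ (row $i$, column $j$) is $c(\square)=j-i$, and for $\mu\subseteq\nu$ let $\dim\nu/\mu$ be the number of standard tableaux of skew shape $\nu/\mu$, with $\dim\nu=\dim\nu/\varnothing$. Realize the algebra of symmetric functions $\mathrm{Sym}_{\mathbb C}=\mathbb C[p_1,p_2,\dots]$ (where the $p_k$ are the Newton power sums) as an algebra of functions on $\mathbb Y$ by the algebra morphism $F\mapsto F(\cdot)$ with $$p_k(\lambda)=\sum_{i\ge1}\Bigl[(\lambda_i-i+\tfrac12)^k-(-i+\tfrac12)^k\Bigr].$$ Let $FS_\mu\in\mathrm{Sym}_{\mathbb C}$ be the Frobenius--Schur function, that is, the element such that for all $\lambda\in\mathbb Y$ and all $N\ge\max(\ell(\mu),\ell(\lambda))$ $$FS_\mu(\lambda)=\frac{\det\bigl[x_j(x_j-1)\cdots(x_j-\mu_i-N+i+1)\bigr]_{i,j=1}^N}{\prod_{1\le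 i<j\le N}(x_i-x_j)},\qquad x_i=\lambda_i+N-i .$$ For complex $z,z',\xi$ with $\xi\ne1$, the Meixner symmetric function with index $\nu\in\mathbb Y$ is $$\mathfrak M_\nu=\sum_{\mu\subseteq\nu}(-1)^{|\nu|-|\mu|}\Bigl(\frac{\xi}{1-\xi}\Bigr)^{|\nu|-|\mu|}\frac{\dim\nu/\mu}{(|\nu|-|\mu|)!}\prod_{\square\in\nu/\mu}(z+c(\square))(z'+c(\square))\; FS_\mu .$$ Assume $\xi\ne0,1$, and let $\nu,\lambda\in\mathbb Y$ be such that $(z+c(\square))(z'+c(\square))\ne0$ for all boxes $\square$ of $\nu$ and of $\lambda$ (this holds for all $\nu,\lambda$ when $z,z'\notin\mathbb Z$). Define $\mathfrak M'_\nu$ (and likewise $\mathfrak M'_\lambda$) by the change of standardization $$\mathfrak M_\nu=\Bigl(\frac{\xi}{\xi-1}\Bigr)^{|\nu|}\frac{\dim\nu}{|\nu|!}\prod_{\square\in\nu}(z+c(\square))(z'+c(\square))\;\mathfrak M'_\nu .$$ Then $\mathfrak M'_\nu(\lambda)=\mathfrak M'_\lambda(\nu)$. -/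

import Mathlib

namespace MeixnerSym

noncomputable section

/-! ## Symmetric functions as functions on Young diagrams

Young diagrams are Mathlib's; a box is a pair `(i, j)` (row, column), both counted from `0`, the
row lengths are `l.rowLen 0 ≥ l.rowLen 1 ≥ …`, the number of nonzero rows is `l.colLen 0`, and
the number of boxes is `l.card`. -/

/-- The complexified algebra of symmetric functions `ℂ[p₁, p₂, …]`: the polynomial algebra in
the Newton power sums, `MvPolynomial.X k` being `p_k`. -/
abbrev SymC : Type := MvPolynomial ℕ+ ℂ

/-- The value of `p_k` at the diagram `l`, namely `∑_{i ≥ 1} ((l_i - i + 1/2)^k - (-i + 1/2)^k)`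
(rows numbered from `1`; here they are numbered from `0`). It is the supersymmetric power sum of
the modified Frobenius coordinates of `l`. -/
def pval (k : ℕ+) (l : YoungDiagram) : ℂ :=
  ∑ i ∈ Finset.range (l.colLen 0),
    (((l.rowLen i : ℂ) - i - 1 / 2) ^ (k : ℕ) - (-(i : ℂ) - 1 / 2) ^ (k : ℕ))

/-- The realization of symmetric functions as functions on Young diagrams: the algebra morphism
that sends the generator `p_k` to the function `pval k`. -/
def value (F : SymC) (l : YoungDiagram) : ℂ := MvPolynomial.eval (fun k => pval k l) F

/-- The factorial Schur polynomial in `N` variables, at a point with distinct coordinates: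
`det[x_j (x_j - 1) ⋯ (x_j - n_i + 1)] / ∏_{i < j} (x_i - x_j)`, where `n_i = ν_i + N - i`
for `1 ≤ i ≤ N`. -/
def factorialSchur (n : YoungDiagram) (N : ℕ) (x : Fin N → ℂ) : ℂ :=
  (Matrix.of fun i j : Fin N => (descPochhammer ℂ (n.rowLen i + (N - 1 - i))).eval (x j)).det /
    ∏ i, ∏ j ∈ Finset.Ioi i, (x i - x j)

/-- The point `(l_1 + N - 1, l_2 + N - 2, …, l_N)` attached to a diagram. -/
def point (N : ℕ) (l : YoungDiagram) : Fin N → ℂ := fun i => ((l.rowLen i + (N - 1 - i) : ℕ) : ℂ)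

/-! ## Existence of the Frobenius-Schur functions

The facts up to `exists_FS` serve only to prove that the functions
`l ↦ factorialSchur n N (point N l)` come from elements of `SymC`. -/

theorem rowLen_eq_zero {l : YoungDiagram} {i : ℕ} (h : l.colLen 0 ≤ i) : l.rowLen i = 0 := by
  by_contra h0
  have : (i, 0) ∈ l := YoungDiagram.mem_iff_lt_rowLen.2 (Nat.pos_of_ne_zero h0)
  have := YoungDiagram.mem_iff_lt_colLen.1 this
  omega

def IsPol (f : YoungDiagram → ℂ) : Prop := ∃ F : MvPolynomial ℕ+ ℂ, ∀ l, value F l = f l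

theorem IsPol.add {f g : YoungDiagram → ℂ} (hf : IsPol f) (hg : IsPol g) :
    IsPol (fun l => f l + g l) := by
  obtain ⟨F, hF⟩ := hf; obtain ⟨G, hG⟩ := hg
  exact ⟨F + G, fun l => by simp [← hF, ← hG, value]⟩
theorem IsPol.mul {f g : YoungDiagram → ℂ} (hf : IsPol f) (hg : IsPol g) :
    IsPol (fun l => f l * g l) := by
  obtain ⟨F, hF⟩ := hf; obtain ⟨G, hG⟩ := hg
  exact ⟨F * G, fun l => by simp [← hF, ← hG, value]⟩
theorem IsPol.const (a : ℂ) : IsPol (fun _ => a) := ⟨MvPolynomial.C a, fun l => by simp [value]⟩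
theorem IsPol.sum {ι : Type*} (s : Finset ι) {f : ι → YoungDiagram → ℂ}
    (hf : ∀ i ∈ s, IsPol (f i)) : IsPol (fun l => ∑ i ∈ s, f i l) := by
  classical
  induction s using Finset.induction_on with
  | empty => simpa using IsPol.const 0
  | insert a s ha ih =>
    simp only [Finset.sum_insert ha]
    exact (hf a (by simp)).add (ih fun i hi => hf i (by simp [hi]))
theorem IsPol.prod {ι : Type*} (s : Finset ι) {f : ι → YoungDiagram → ℂ}
    (hf : ∀ i ∈ s, IsPol (f i)) : IsPol (fun l => ∏ i ∈ s, f i l) := by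
  classical
  induction s using Finset.induction_on with
  | empty => simpa using IsPol.const 1
  | insert a s ha ih =>
    simp only [Finset.prod_insert ha]
    exact (hf a (by simp)).mul (ih fun i hi => hf i (by simp [hi]))
theorem IsPol.pval (k : ℕ+) : IsPol (pval k) := ⟨MvPolynomial.X k, fun l => by simp [value]⟩

open PowerSeries in
theorem geom_mul (v : ℂ) : (1 - C v * X : PowerSeries ℂ) * mk (fun n => v ^ n) = 1 := by
  ext n
  rw [sub_mul, one_mul, mul_assoc]
  cases n with
  | zero => simp
  | succ n => simp [PowerSeries.coeff_succ_X_mul, pow_succ, mul_comm,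
      PowerSeries.coeff_one]

open PowerSeries in
def factor (w v : ℂ) : PowerSeries ℂ := (1 - C w * X) * mk (fun n => v ^ n)

open PowerSeries in
theorem factor_self (w : ℂ) : factor w w = 1 := geom_mul w

open PowerSeries in
theorem derivative_factor (w v : ℂ) :
    derivative ℂ (factor w v) = factor w v * mk (fun n => v ^ (n + 1) - w ^ (n + 1)) := by
  have hw := geom_mul w
  have hv := geom_mul v
  have hL : (mk (fun n => v ^ (n + 1) - w ^ (n + 1)) : PowerSeries ℂ)
      = C v * mk (fun n => v ^ n) - C w * mk (fun n => w ^ n) := by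
    ext n; simp [pow_succ, mul_comm]
  have hv' := congrArg (derivative ℂ) hv
  rw [hL, factor]
  set G : PowerSeries ℂ := mk (fun n => v ^ n)
  set H : PowerSeries ℂ := mk (fun n => w ^ n)
  have e : ∀ a : ℂ, derivative ℂ (1 - C a * X : PowerSeries ℂ) = - C a := by
    intro a; ext n; cases n <;> simp [PowerSeries.coeff_derivative, PowerSeries.coeff_C, PowerSeries.coeff_one, PowerSeries.coeff_X]
  simp only [Derivation.leibniz, e, smul_eq_mul, Derivation.map_one_eq_zero] at hv' ⊢
  linear_combination (1 - C w * X) * (G * hv' - derivative ℂ G * hv) + C w * G * hw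

open PowerSeries in
theorem derivative_prod {ι : Type*} (s : Finset ι) (F L : ι → PowerSeries ℂ)
    (h : ∀ i ∈ s, derivative ℂ (F i) = F i * L i) :
    derivative ℂ (∏ i ∈ s, F i) = (∏ i ∈ s, F i) * ∑ i ∈ s, L i := by
  classical
  induction s using Finset.induction_on with
  | empty => simp
  | insert a s ha ih =>
    rw [Finset.prod_insert ha, Finset.sum_insert ha, Derivation.leibniz, h a (by simp),
      ih fun i hi => h i (by simp [hi])]
    simp only [smul_eq_mul]; ring

def ww (l : YoungDiagram) (j : ℕ) : ℂ := (l.rowLen j : ℂ) - j - 1 / 2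
def vv (j : ℕ) : ℂ := -(j : ℂ) - 1 / 2

theorem ww_ne_zero (l : YoungDiagram) (j : ℕ) : ww l j ≠ 0 := by
  intro h
  have h1 : ((2 * (l.rowLen j : ℤ) - 2 * j : ℤ) : ℂ) = (1 : ℤ) := by
    push_cast; unfold ww at h; linear_combination 2 * h
  have := Int.cast_injective h1
  omega

theorem ww_eq_vv {l : YoungDiagram} {j : ℕ} (h : l.colLen 0 ≤ j) : ww l j = vv j := by
  simp [ww, vv, rowLen_eq_zero h]

def DD (l : YoungDiagram) : PowerSeries ℂ :=
  ∏ j ∈ Finset.range (l.colLen 0), factor (ww l j) (vv j)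

theorem DD_eq (l : YoungDiagram) {N : ℕ} (h : l.colLen 0 ≤ N) :
    DD l = ∏ j ∈ Finset.range N, factor (ww l j) (vv j) := by
  apply Finset.prod_subset (by simpa using h)
  intro j _ hj
  rw [ww_eq_vv (by simpa using hj), factor_self]

open PowerSeries in
theorem coeff_DD_succ (l : YoungDiagram) (n : ℕ) :
    coeff (n + 1) (DD l) = - (((n : ℂ) + 1)⁻¹ * ∑ x ∈ Finset.HasAntidiagonal.antidiagonal n,
      coeff x.1 (DD l) * pval ⟨x.2 + 1, Nat.succ_pos _⟩ l) := by
  have h := derivative_prod (Finset.range (l.colLen 0)) (fun j => factor (ww l j) (vv j)) _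
    (fun j _ => derivative_factor (ww l j) (vv j))
  have h2 := congrArg (coeff n) h
  rw [PowerSeries.coeff_derivative, PowerSeries.coeff_mul] at h2
  have h3 : (n : ℂ) + 1 ≠ 0 := by exact_mod_cast Nat.succ_ne_zero n
  rw [← mul_neg, eq_inv_mul_iff_mul_eq₀ h3, mul_comm]
  refine h2.trans ?_
  rw [← Finset.sum_neg_distrib]
  refine Finset.sum_congr rfl fun x _ => ?_
  rw [← mul_neg]
  congr 1
  simp only [map_sum, coeff_mk, pval, ← Finset.sum_neg_distrib]
  refine Finset.sum_congr rfl fun j _ => ?_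
  simp only [ww, vv, PNat.mk_coe]; ring

open PowerSeries in
theorem IsPol.coeff_DD (n : ℕ) : IsPol (fun l => coeff n (DD l)) := by
  induction n using Nat.strong_induction_on with
  | _ n ih =>
    cases n with
    | zero =>
      convert IsPol.const 1 using 2 with l
      simp [DD, factor, map_prod]
    | succ n =>
      simp only [coeff_DD_succ]
      have := ((IsPol.const (-((n : ℂ) + 1)⁻¹)).mul
        (IsPol.sum (Finset.HasAntidiagonal.antidiagonal n) (f := fun x l => coeff x.1 (DD l) *
          MeixnerSym.pval ⟨x.2 + 1, Nat.succ_pos _⟩ l) fun x hx => (ih x.1 (by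
            have := Finset.HasAntidiagonal.mem_antidiagonal.1 hx; omega)).mul (IsPol.pval _)))
      simpa [neg_mul] using this

open PowerSeries in
def Psi (k : ℕ) : PowerSeries ℂ := ∏ i ∈ Finset.range k, mk (fun n => vv i ^ n)

open PowerSeries in
def eps (l : YoungDiagram) : ℕ → ℂ
  | n => coeff n (DD l) - ∑ k : Fin n, eps l k * coeff (n - k) (Psi k)

open PowerSeries in
theorem coeff_zero_Psi (k : ℕ) : coeff 0 (Psi k) = 1 := by
  simp [Psi, map_prod]

open PowerSeries in
theorem coeff_DD_eq (l : YoungDiagram) (n : ℕ) :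
    coeff n (DD l) = ∑ k ∈ Finset.range (n + 1), eps l k * coeff (n - k) (Psi k) := by
  rw [Finset.sum_range_succ, Nat.sub_self, coeff_zero_Psi, mul_one]
  conv_rhs => rw [eps, ← Fin.sum_univ_eq_sum_range (fun k => eps l k * coeff (n - k) (Psi k))]
  ring

theorem IsPol.eps (n : ℕ) : IsPol (fun l => eps l n) := by
  induction n using Nat.strong_induction_on with
  | _ n ih =>
    have := (IsPol.coeff_DD n).add ((IsPol.const (-1)).mul
      (IsPol.sum Finset.univ (f := fun (k : Fin n) l => MeixnerSym.eps l k *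
        PowerSeries.coeff (n - k) (Psi k)) fun k _ => (ih k k.2).mul (IsPol.const _)))
    convert this using 2 with l
    rw [MeixnerSym.eps]; ring

theorem eps_zero (l : YoungDiagram) : eps l 0 = 1 := by
  rw [eps]; simp [DD, factor, map_prod]

open PowerSeries in
theorem Psi_mul {k N : ℕ} (h : k ≤ N) :
    Psi k * ∏ i ∈ Finset.range N, (1 - C (vv i) * X) =
      ∏ i ∈ Finset.Ico k N, (1 - C (vv i) * X) := by
  rw [← Finset.prod_range_mul_prod_Ico _ h, ← mul_assoc, Psi, ← Finset.prod_mul_distrib]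
  simp [mul_comm (mk _), geom_mul]

theorem poly_identity (l : YoungDiagram) {N : ℕ} (h : l.colLen 0 ≤ N) :
    (∏ j ∈ Finset.range N, (1 - Polynomial.C (ww l j) * Polynomial.X) : Polynomial ℂ) =
      ∑ k ∈ Finset.range (N + 1), Polynomial.C (eps l k) * Polynomial.X ^ k *
        ∏ i ∈ Finset.Ico k N, (1 - Polynomial.C (vv i) * Polynomial.X) := by
  set P : Polynomial ℂ := ∏ j ∈ Finset.range N, (1 - Polynomial.C (ww l j) * Polynomial.X)
  set R : Polynomial ℂ := ∑ k ∈ Finset.range (N + 1), Polynomial.C (eps l k) * Polynomial.X ^ k *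
        ∏ i ∈ Finset.Ico k N, (1 - Polynomial.C (vv i) * Polynomial.X)
  have hd1 : ∀ a : ℂ, (1 - Polynomial.C a * Polynomial.X).natDegree ≤ 1 := fun a => by compute_degree
  have hP : P.natDegree ≤ N := by
    refine (Polynomial.natDegree_prod_le _ _).trans ?_
    refine (Finset.sum_le_sum fun i _ => hd1 _).trans (by simp)
  have hR : R.natDegree ≤ N := by
    refine Polynomial.natDegree_sum_le_of_forall_le _ _ fun k hk => ?_
    have hk : k ≤ N := by simpa [Nat.lt_succ_iff] using hk
    refine Polynomial.natDegree_mul_le.trans ?_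
    have h1 := Polynomial.natDegree_C_mul_X_pow_le (eps l k) k
    have h2 : (∏ i ∈ Finset.Ico k N, (1 - Polynomial.C (vv i) * Polynomial.X)).natDegree ≤ N - k := by
      refine (Polynomial.natDegree_prod_le _ _).trans ?_
      refine (Finset.sum_le_sum fun i _ => hd1 _).trans (by simp)
    omega
  let Q : PowerSeries ℂ := ∏ i ∈ Finset.range N, (1 - PowerSeries.C (vv i) * PowerSeries.X)
  let S : PowerSeries ℂ := ∑ k ∈ Finset.range (N + 1),
    PowerSeries.C (eps l k) * PowerSeries.X ^ k * Psi k
  have hcoe : ∀ a : ℂ, ((1 - Polynomial.C a * Polynomial.X : Polynomial ℂ) : PowerSeries ℂ) =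
      1 - PowerSeries.C a * PowerSeries.X := fun a => by simp
  have hPc : (P : PowerSeries ℂ) = DD l * Q := by
    rw [DD_eq l h, ← Finset.prod_mul_distrib, ← Polynomial.coeToPowerSeries.ringHom_apply, map_prod]
    refine Finset.prod_congr rfl fun i _ => ?_
    rw [Polynomial.coeToPowerSeries.ringHom_apply, hcoe, factor, mul_assoc, mul_comm (PowerSeries.mk _),
      geom_mul, mul_one]
  have hRc : (R : PowerSeries ℂ) = S * Q := by
    rw [Finset.sum_mul, ← Polynomial.coeToPowerSeries.ringHom_apply, map_sum]
    refine Finset.sum_congr rfl fun k hk => ?_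
    have hk : k ≤ N := by simpa [Nat.lt_succ_iff] using hk
    rw [mul_assoc (_ * _) (Psi k) Q, Psi_mul hk, map_mul, map_prod]
    simp [hcoe]
  have hS : ∀ n < N + 1, PowerSeries.coeff n (DD l - S) = 0 := by
    intro n hn
    rw [map_sub, coeff_DD_eq, sub_eq_zero]
    simp only [S, map_sum]
    have h0 : Finset.range (n + 1) ⊆ Finset.range (N + 1) := by
      intro; simp; omega
    rw [← Finset.sum_subset h0]
    · refine Finset.sum_congr rfl fun k hk => ?_
      have hk : k ≤ n := by simpa [Nat.lt_succ_iff] using hk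
      rw [mul_assoc, PowerSeries.coeff_C_mul, PowerSeries.coeff_X_pow_mul', if_pos hk]
    · intro k _ hk
      have hk : ¬ k ≤ n := by simpa [Nat.lt_succ_iff] using hk
      rw [mul_assoc, PowerSeries.coeff_C_mul, PowerSeries.coeff_X_pow_mul', if_neg hk, mul_zero]
  have hdvd : (PowerSeries.X : PowerSeries ℂ) ^ (N + 1) ∣ ((P - R : Polynomial ℂ) : PowerSeries ℂ) := by
    rw [Polynomial.coe_sub, hPc, hRc, ← sub_mul]
    exact (PowerSeries.X_pow_dvd_iff.2 hS).mul_right _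
  rw [← sub_eq_zero]
  ext n
  by_cases hn : n < N + 1
  · rw [← Polynomial.coeff_coe, PowerSeries.X_pow_dvd_iff.1 hdvd n hn]; simp
  · rw [Polynomial.coeff_eq_zero_of_natDegree_lt]
    · simp
    · exact lt_of_le_of_lt (Polynomial.natDegree_sub_le_of_le hP hR) (by simp; omega)

theorem eps_succ_eq_zero (l : YoungDiagram) {N : ℕ} (h : l.colLen 0 ≤ N) : eps l (N + 1) = 0 := by
  have h1 := poly_identity l (N := N + 1) (by omega)
  have h2 := poly_identity l h
  rw [Finset.prod_range_succ, h2, Finset.sum_range_succ _ (N + 1), ww_eq_vv h, Finset.sum_mul,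
    Finset.Ico_self, Finset.prod_empty, mul_one] at h1
  have h3 : ∀ k ∈ Finset.range (N + 1), Polynomial.C (eps l k) * Polynomial.X ^ k *
      (∏ i ∈ Finset.Ico k N, (1 - Polynomial.C (vv i) * Polynomial.X)) *
        (1 - Polynomial.C (vv N) * Polynomial.X) = Polynomial.C (eps l k) * Polynomial.X ^ k *
      ∏ i ∈ Finset.Ico k (N + 1), (1 - Polynomial.C (vv i) * Polynomial.X) := by
    intro k hk
    rw [Finset.prod_Ico_succ_top (by simpa [Nat.lt_succ_iff] using hk), mul_assoc]
  rw [Finset.sum_congr rfl h3, left_eq_add] at h1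
  simpa using congrArg (fun p => Polynomial.coeff p (N + 1)) h1

theorem eps_eq_zero (l : YoungDiagram) {N : ℕ} (h : l.colLen 0 ≤ N) (n : ℕ) (hn : N < n) :
    eps l n = 0 := by
  obtain ⟨m, rfl⟩ := Nat.exists_eq_succ_of_ne_zero (by omega : n ≠ 0)
  exact eps_succ_eq_zero l (by omega)

def fall (n : ℕ) (x : ℂ) : ℂ := (descPochhammer ℂ n).eval x

theorem fall_succ (n : ℕ) (x : ℂ) : fall (n + 1) x = fall n x * (x - n) :=
  descPochhammer_succ_eval n x

theorem fall_eq_prod (N : ℕ) (w : ℂ) (k : ℕ) (hk : k ≤ N) :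
    ∏ i ∈ Finset.Ico k N, (w - vv i) = fall (N - k) (w + N - 1 / 2) := by
  rw [fall, descPochhammer_eval_eq_prod_range, Finset.prod_Ico_eq_prod_range,
    ← Finset.prod_range_reflect]
  refine Finset.prod_congr rfl fun j hj => ?_
  have hj : j < N - k := by simpa using hj
  have : ((k + (N - k - 1 - j) : ℕ) : ℂ) = (N : ℂ) - 1 - j := by
    rw [show k + (N - k - 1 - j) = N - 1 - j by omega, Nat.cast_sub (by omega),
      Nat.cast_sub (by omega)]
    simp
  rw [vv, this]; ring

theorem fall_relation (l : YoungDiagram) {N : ℕ} (h : l.colLen 0 ≤ N) {j : ℕ} (hj : j < N) :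
    ∑ k ∈ Finset.range (N + 1), eps l k * fall (N - k) (ww l j + N - 1 / 2) = 0 := by
  have h1 := congrArg (Polynomial.eval (ww l j)⁻¹) (poly_identity l h)
  have hw := ww_ne_zero l j
  rw [Polynomial.eval_prod, Finset.prod_eq_zero (Finset.mem_range.2 hj) (by simp [hw]),
    Polynomial.eval_finsetSum] at h1
  rw [← mul_zero (ww l j ^ N), h1, Finset.mul_sum]
  refine Finset.sum_congr rfl fun k hk => ?_
  have hk : k ≤ N := by simpa [Nat.lt_succ_iff] using hk
  rw [← fall_eq_prod _ _ _ hk, Polynomial.eval_mul, Polynomial.eval_prod]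
  have e : ∏ i ∈ Finset.Ico k N, (ww l j - vv i) = ww l j ^ (N - k) *
      ∏ i ∈ Finset.Ico k N, (1 - vv i * (ww l j)⁻¹) := by
    rw [← Nat.card_Ico, ← Finset.prod_const, ← Finset.prod_mul_distrib]
    refine Finset.prod_congr rfl fun i _ => ?_
    field_simp
  have e2 : ww l j ^ N = ww l j ^ k * ww l j ^ (N - k) := by rw [← pow_add]; congr 1; omega
  rw [e, e2]
  simp
  field_simp

def cc (l : YoungDiagram) : ℕ → ℕ → ℂ
  | 0, k => - eps l (k + 1)
  | m + 1, k => cc l m (k + 1) - (m + k + 1) * cc l m k - cc l m 0 * eps l (k + 1)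

theorem IsPol.cc (m k : ℕ) : IsPol (fun l => cc l m k) := by
  induction m generalizing k with
  | zero =>
    convert (IsPol.const (-1)).mul (IsPol.eps (k + 1)) using 2 with l
    simp [MeixnerSym.cc]
  | succ m ih =>
    convert ((ih (k + 1)).add ((IsPol.const (-((m : ℂ) + k + 1))).mul (ih k))).add
      ((IsPol.const (-1)).mul ((ih 0).mul (IsPol.eps (k + 1)))) using 2 with l
    simp only [MeixnerSym.cc]; ring

theorem cc_eq_zero (l : YoungDiagram) {N : ℕ} (h : l.colLen 0 ≤ N) (m k : ℕ) (hk : N ≤ k) :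
    cc l m k = 0 := by
  induction m generalizing k with
  | zero => simp [cc, eps_eq_zero l h (k + 1) (by omega)]
  | succ m ih => simp [cc, ih _ hk, ih (k + 1) (by omega), eps_eq_zero l h (k + 1) (by omega)]

theorem fall_expand (l : YoungDiagram) {N : ℕ} (h : l.colLen 0 ≤ N) {j : ℕ} (hj : j < N) (m : ℕ) :
    fall (N + m) (ww l j + N - 1 / 2) =
      ∑ k ∈ Finset.range N, cc l m k * fall (N - 1 - k) (ww l j + N - 1 / 2) := by
  have h0 : fall N (ww l j + N - 1 / 2) =
      ∑ k ∈ Finset.range N, - eps l (k + 1) * fall (N - 1 - k) (ww l j + N - 1 / 2) := by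
    have := fall_relation l h hj
    rw [Finset.sum_range_succ', eps_zero, one_mul, Nat.sub_zero] at this
    rw [eq_neg_of_add_eq_zero_right this, ← Finset.sum_neg_distrib]
    refine Finset.sum_congr rfl fun k _ => ?_
    rw [neg_mul, show N - (k + 1) = N - 1 - k by omega]
  set x := ww l j + N - 1 / 2
  induction m with
  | zero => simpa [cc] using h0
  | succ m ih =>
    obtain ⟨M, rfl⟩ : ∃ M, N = M + 1 := ⟨N - 1, by omega⟩
    rw [← add_assoc, fall_succ, ih, Finset.sum_mul]
    simp only [cc, sub_mul, Finset.sum_sub_distrib]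
    have e1 : ∑ k ∈ Finset.range (M + 1), cc l m 0 * eps l (k + 1) * fall (M + 1 - 1 - k) x =
        - (cc l m 0 * fall (M + 1) x) := by
      rw [h0, Finset.mul_sum, ← Finset.sum_neg_distrib]
      refine Finset.sum_congr rfl fun k _ => ?_
      ring
    have e2 : ∑ k ∈ Finset.range (M + 1), cc l m (k + 1) * fall (M + 1 - 1 - k) x =
        (∑ k ∈ Finset.range (M + 1), cc l m k * fall (M + 1 - k) x) - cc l m 0 * fall (M + 1) x := by
      rw [Finset.sum_range_succ, cc_eq_zero l h m (M + 1) le_rfl, Finset.sum_range_succ' (n := M)]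
      simp
    rw [e1, e2]
    have e3 : ∀ k ∈ Finset.range (M + 1),
        cc l m k * fall (M + 1 - 1 - k) x * (x - (M + 1 + m : ℕ)) =
        cc l m k * fall (M + 1 - k) x - (m + k + 1) * cc l m k * fall (M + 1 - 1 - k) x := by
      intro k hk
      have hk : k ≤ M := by simpa [Nat.lt_succ_iff] using hk
      rw [show M + 1 - k = (M - k) + 1 by omega, fall_succ, Nat.add_sub_cancel, Nat.cast_sub hk]
      push_cast; ring
    rw [Finset.sum_congr rfl e3, Finset.sum_sub_distrib]
    ring

def gg (n l : YoungDiagram) (i k : ℕ) : ℂ :=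
  if i < n.rowLen i then cc l (n.rowLen i - i - 1) k else if k = i - n.rowLen i then 1 else 0

theorem IsPol.gg (n : YoungDiagram) (i k : ℕ) : IsPol (fun l => gg n l i k) := by
  unfold MeixnerSym.gg
  split_ifs
  · exact IsPol.cc _ _
  · exact IsPol.const _
  · exact IsPol.const _

theorem point_eq {N : ℕ} (l : YoungDiagram) (j : Fin N) : point N l j = ww l j + N - 1 / 2 := by
  have := j.2
  rw [point, ww, Nat.cast_add, Nat.cast_sub (by omega), Nat.cast_sub (by omega)]
  push_cast; ring

theorem matrix_eq (n l : YoungDiagram) {N : ℕ} (h : l.colLen 0 ≤ N) :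
    (Matrix.of fun i j : Fin N => fall (n.rowLen i + (N - 1 - i)) (point N l j)) =
      (Matrix.of fun i k : Fin N => gg n l i k) *
        (Matrix.of fun k j : Fin N => fall (N - 1 - k) (point N l j)) := by
  ext i j
  simp only [Matrix.mul_apply, Matrix.of_apply]
  rw [Fin.sum_univ_eq_sum_range (fun k => gg n l i k * fall (N - 1 - k) (point N l j)), point_eq]
  have hi := i.2
  by_cases hr : (i : ℕ) < n.rowLen i
  · simp only [gg, if_pos hr]
    rw [← fall_expand l h j.2]
    congr 1; omega
  · simp only [gg, if_neg hr, ite_mul, one_mul, zero_mul]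
    rw [Finset.sum_ite_eq', if_pos (by simp; omega)]
    congr 1; omega

theorem det_fall {N : ℕ} (x : Fin N → ℂ) :
    (Matrix.of fun k j : Fin N => fall (N - 1 - k) (x j)).det =
      ∏ i, ∏ j ∈ Finset.Ioi i, (x i - x j) := by
  have h1 := Matrix.det_eval_matrixOfPolynomials_eq_det_vandermonde (fun j => x j.rev)
    (fun i : Fin N => descPochhammer ℂ i) (fun i => descPochhammer_natDegree ℂ i)
    (fun i => monic_descPochhammer ℂ i)
  rw [Matrix.det_vandermonde] at h1
  rw [← Matrix.det_transpose, ← Matrix.det_submatrix_equiv_self Fin.revPerm]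
  have e : (Matrix.of fun k j : Fin N => fall (N - 1 - k) (x j)).transpose.submatrix
      Fin.revPerm Fin.revPerm = Matrix.of fun i j : Fin N => (descPochhammer ℂ j).eval (x i.rev) := by
    ext i j
    have := j.2
    simp only [Matrix.submatrix_apply, Matrix.transpose_apply, Matrix.of_apply, Fin.revPerm_apply, fall,
      Fin.val_rev]
    congr 2; omega
  rw [e, ← h1]
  have key : ∀ f : Fin N → Fin N → ℂ, ∏ i, ∏ j ∈ Finset.Ioi i, f i j =
      ∏ i, ∏ j, if i < j then f i j else 1 := by
    intro f
    refine Finset.prod_congr rfl fun i _ => ?_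
    rw [← Finset.prod_filter]
    congr 1; ext j; simp
  rw [key, key, Finset.prod_comm, ← Equiv.prod_comp Fin.revPerm]
  refine Finset.prod_congr rfl fun i _ => ?_
  rw [← Equiv.prod_comp Fin.revPerm]
  refine Finset.prod_congr rfl fun j _ => ?_
  simp [Fin.rev_lt_rev]

theorem vand_ne_zero (l : YoungDiagram) (N : ℕ) :
    ∏ i, ∏ j ∈ Finset.Ioi i, (point N l i - point N l j) ≠ 0 := by
  refine Finset.prod_ne_zero_iff.2 fun i _ => Finset.prod_ne_zero_iff.2 fun j hj => ?_
  have hij : (i : ℕ) < j := by simpa using hj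
  have h1 := l.rowLen_anti i j hij.le
  have := j.2
  rw [sub_ne_zero, point, point, Ne, Nat.cast_inj]
  omega

theorem det_gg (n l : YoungDiagram) (N : ℕ) (h : n.colLen 0 ≤ N) :
    (Matrix.of fun i k : Fin N => gg n l i k).det =
      (Matrix.of fun i k : Fin (n.colLen 0) => gg n l i k).det := by
  induction N, h using Nat.le_induction with
  | base => rfl
  | succ N h ih =>
    have hrow : ∀ k, gg n l N k = if k = N then 1 else 0 := by
      intro k
      simp [gg, rowLen_eq_zero h]
    rw [Matrix.det_succ_row _ (Fin.last N), Finset.sum_eq_single (Fin.last N)]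
    · rw [← ih]
      simp [hrow, ← two_mul, Matrix.submatrix]
    · intro b _ hb
      have : (b : ℕ) ≠ N := fun h' => hb (Fin.ext h')
      simp [hrow, this]
    · simp

theorem exists_FS (n : YoungDiagram) : ∃ F : MvPolynomial ℕ+ ℂ, ∀ (l : YoungDiagram) (N : ℕ),
    n.colLen 0 ≤ N → l.colLen 0 ≤ N → value F l = factorialSchur n N (point N l) := by
  obtain ⟨F, hF⟩ : IsPol (fun l => (Matrix.of fun i k : Fin (n.colLen 0) => gg n l i k).det) := by
    simp only [Matrix.det_apply', Matrix.of_apply]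
    exact IsPol.sum _ fun σ _ => (IsPol.const _).mul (IsPol.prod _ fun i _ => IsPol.gg _ _ _)
  refine ⟨F, fun l N hn hl => ?_⟩
  have := matrix_eq n l hl
  simp only [fall] at this
  rw [hF, factorialSchur, this, Matrix.det_mul, det_gg n l N hn]
  have h2 := det_fall (point N l)
  simp only [fall] at h2
  rw [h2, mul_div_cancel_right₀ _ (vand_ne_zero l N)]

/-! ## Frobenius-Schur functions and Meixner symmetric functions -/

/-- The Frobenius-Schur function, that is, the element of `SymC` whose value at every diagram `l`
is the value of the shifted Schur function at the row lengths of `l`: for every `N` at least the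
numbers of rows of `n` and of `l`, it is `factorialSchur n N` at `l_i + N - i`. -/
def frobeniusSchur (n : YoungDiagram) : SymC := (exists_FS n).choose

theorem value_frobeniusSchur (n l : YoungDiagram) (N : ℕ) (hn : n.colLen 0 ≤ N)
    (hl : l.colLen 0 ≤ N) : value (frobeniusSchur n) l = factorialSchur n N (point N l) :=
  (exists_FS n).choose_spec l N hn hl

/-- The content `j - i` of the box `(i, j)`. -/
def content (b : ℕ × ℕ) : ℂ := (b.2 : ℂ) - (b.1 : ℂ)

/-- The number `dim n/m` of standard tableaux of skew shape `n/m`: bijective numberings of the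
boxes that increase along rows and down columns. -/
def skewDim (n m : YoungDiagram) : ℕ :=
  Nat.card {T : {b // b ∈ n.cells \ m.cells} ≃ Fin (n.cells \ m.cells).card //
    ∀ a b, ((a.1.1 = b.1.1 ∧ a.1.2 < b.1.2) ∨ (a.1.2 = b.1.2 ∧ a.1.1 < b.1.1)) → T a < T b}

/-- The number of standard tableaux of shape `n`. -/
def dim (n : YoungDiagram) : ℕ := skewDim n ⊥

theorem finite_subdiagrams (n : YoungDiagram) : {m : YoungDiagram | m ≤ n}.Finite := by
  refine Set.Finite.of_finite_image (f := YoungDiagram.cells)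
    ((n.cells.powerset.finite_toSet).subset ?_) fun a _ b _ h => YoungDiagram.ext h
  rintro _ ⟨m, hm, rfl⟩
  simpa using YoungDiagram.cells_subset_iff.2 hm

/-- The finite set of diagrams contained in `n`. -/
def subdiagrams (n : YoungDiagram) : Finset YoungDiagram := (finite_subdiagrams n).toFinset

/-- The product of `(z + c(b)) (z' + c(b))` over the boxes `b` of the skew diagram `n/m`. -/
def contentProd (z z' : ℂ) (n m : YoungDiagram) : ℂ :=
  ∏ b ∈ n.cells \ m.cells, (z + content b) * (z' + content b)

/-- The Meixner symmetric function with index `n` and parameters `z, z', ξ`. -/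
def meixner (z z' ξ : ℂ) (n : YoungDiagram) : SymC :=
  ∑ m ∈ subdiagrams n,
    ((-1) ^ (n.card - m.card) * (ξ / (1 - ξ)) ^ (n.card - m.card) *
      ((skewDim n m : ℂ) / ((n.card - m.card).factorial : ℂ)) * contentProd z z' n m) •
        frobeniusSchur m

/-- The normalizing factor `(ξ/(ξ-1))^{|n|} (dim n/|n|!) ∏ (z + c(b)) (z' + c(b))`, the product
being over all boxes `b` of `n`. -/
def normFactor (z z' ξ : ℂ) (n : YoungDiagram) : ℂ :=
  (ξ / (ξ - 1)) ^ n.card * ((dim n : ℂ) / (n.card.factorial : ℂ)) * contentProd z z' n ⊥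

/-- The Meixner symmetric function divided by its normalizing factor (which must be nonzero). -/
def meixnerNormalized (z z' ξ : ℂ) (n : YoungDiagram) : SymC :=
  (normFactor z z' ξ n)⁻¹ • meixner z z' ξ n

end

end MeixnerSym

/-! Put `q = ξ / (ξ - 1)` and let `C(μ)` be the product of `(z + c)(z' + c)` over the boxes of `μ`.
The identity comes from an explicitly symmetric expansion, `𝔐'_ν(λ) = ∑_μ FS_μ(ν) FS_μ(λ) / (q^|μ|
C(μ))`, the sum running over the `μ` contained in both `ν` and `λ` (`value_meixnerNormalized`).

Two facts about Frobenius-Schur functions produce it. First, `FS_μ(ν) = (dim ν/μ / (|ν|-|μ|)!) /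
(dim ν / |ν|!)` for `μ ⊆ ν`. Hence the skew dimension in the definition of `𝔐_ν`, divided by the
normalizing factor, is itself a value `FS_μ(ν)`, while powers of `q` and content products over `ν/μ`
and `ν` leave only those over `μ`. Second, `FS_μ(λ) = 0` unless `μ ⊆ λ`, which restricts the sum to
common subdiagrams.

Both facts are read off from determinants. At integer points a falling factorial is a quotient of
factorials, so `FS_μ(λ)` is a ratio of two determinants `det[1/(b_j - a_i)!]`
(`factorialSchur_point`). Such a determinant is Aitken's expression for `dim λ/μ / (|λ|-|μ|)!`
(`factorial_mul_factDet`): it satisfies the same recurrence as standard tableaux do under removal of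
the largest entry. -/

namespace MeixnerSym

/-! ## Standard tableaux of an arbitrary finite set of boxes -/

/-- The box `b` lies strictly to the right of `a` in its row or strictly below it in its column. -/
def Precedes (a b : ℕ × ℕ) : Prop := (a.1 = b.1 ∧ a.2 < b.2) ∨ (a.2 = b.2 ∧ a.1 < b.1)

/-- The standard numberings of a set of boxes by `Fin n`. -/
abbrev Tableau (S : Finset (ℕ × ℕ)) (n : ℕ) : Type :=
  {T : {b // b ∈ S} ≃ Fin n // ∀ a b, Precedes a.1 b.1 → T a < T b}

/-- The box `c` precedes no box of `S`. -/
def IsOuter (S : Finset (ℕ × ℕ)) (c : ℕ × ℕ) : Prop := ∀ b ∈ S, ¬ Precedes c b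

/-- Appending the largest entry in an outer box. -/
def extendEquiv {S : Finset (ℕ × ℕ)} {n : ℕ} (c : ℕ × ℕ) (hc : c ∈ S)
    (T : {b // b ∈ S.erase c} ≃ Fin n) : {b // b ∈ S} ≃ Fin (n + 1) where
  toFun b := if h : b.1 = c then Fin.last n
    else (T ⟨b.1, Finset.mem_erase.2 ⟨h, b.2⟩⟩).castSucc
  invFun := Fin.lastCases ⟨c, hc⟩ fun i => ⟨(T.symm i).1, Finset.mem_of_mem_erase (T.symm i).2⟩
  left_inv b := by
    obtain ⟨b, hb⟩ := b
    by_cases h : b = c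
    · subst h; simp
    · simp [h]
  right_inv i := by
    induction i using Fin.lastCases with
    | last => simp
    | cast i =>
      have := (Finset.mem_erase.1 (T.symm i).2).1
      simp [this]

theorem extendEquiv_self {S : Finset (ℕ × ℕ)} {n : ℕ} (c : ℕ × ℕ) (hc : c ∈ S)
    (T : {b // b ∈ S.erase c} ≃ Fin n) : extendEquiv c hc T ⟨c, hc⟩ = Fin.last n := by
  simp [extendEquiv]

theorem extendEquiv_of_ne {S : Finset (ℕ × ℕ)} {n : ℕ} (c : ℕ × ℕ) (hc : c ∈ S)
    (T : {b // b ∈ S.erase c} ≃ Fin n) (b : {b // b ∈ S.erase c}) :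
    extendEquiv c hc T ⟨b.1, Finset.mem_of_mem_erase b.2⟩ = (T b).castSucc := by
  have := (Finset.mem_erase.1 b.2).1
  simp [extendEquiv, this]

/-- Deleting the box that carries the largest entry. -/
def restrictEquiv {S : Finset (ℕ × ℕ)} {n : ℕ} (c : ℕ × ℕ) (hc : c ∈ S)
    (T : {b // b ∈ S} ≃ Fin (n + 1)) (hT : T ⟨c, hc⟩ = Fin.last n) :
    {b // b ∈ S.erase c} ≃ Fin n where
  toFun b := (T ⟨b.1, Finset.mem_of_mem_erase b.2⟩).castPred fun h =>
    (Finset.mem_erase.1 b.2).1 (congrArg Subtype.val (T.injective (h.trans hT.symm)))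
  invFun i := ⟨(T.symm i.castSucc).1, Finset.mem_erase.2 ⟨fun h => by
    have h1 : T.symm i.castSucc = ⟨c, hc⟩ := Subtype.ext h
    rw [Equiv.symm_apply_eq, hT] at h1
    exact Fin.castSucc_ne_last i h1, (T.symm i.castSucc).2⟩⟩
  left_inv b := by simp
  right_inv i := by simp

theorem castSucc_restrictEquiv {S : Finset (ℕ × ℕ)} {n : ℕ} (c : ℕ × ℕ) (hc : c ∈ S)
    (T : {b // b ∈ S} ≃ Fin (n + 1)) (hT : T ⟨c, hc⟩ = Fin.last n) (b : {b // b ∈ S.erase c}) :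
    (restrictEquiv c hc T hT b).castSucc = T ⟨b.1, Finset.mem_of_mem_erase b.2⟩ := by
  simp [restrictEquiv]

theorem extendEquiv_mono {S : Finset (ℕ × ℕ)} {n : ℕ} (c : ℕ × ℕ) (hc : c ∈ S)
    (ho : IsOuter S c) (T : Tableau (S.erase c) n) (a b : {b // b ∈ S})
    (h : Precedes a.1 b.1) : extendEquiv c hc T.1 a < extendEquiv c hc T.1 b := by
  obtain ⟨a, ha⟩ := a
  obtain ⟨b, hb⟩ := b
  by_cases hac : a = c
  · subst hac; exact absurd h (ho b hb)
  have h1 := extendEquiv_of_ne c hc T.1 ⟨a, Finset.mem_erase.2 ⟨hac, ha⟩⟩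
  by_cases hbc : b = c
  · subst hbc
    rw [h1, extendEquiv_self]
    exact Fin.castSucc_lt_last _
  · have h2 := extendEquiv_of_ne c hc T.1 ⟨b, Finset.mem_erase.2 ⟨hbc, hb⟩⟩
    rw [h1, h2, Fin.castSucc_lt_castSucc_iff]
    exact T.2 _ _ h

/-- A standard numbering is an outer box together with a standard numbering of the other boxes. -/
theorem card_tableau_succ (S : Finset (ℕ × ℕ)) (n : ℕ) [DecidablePred (IsOuter S)] :
    Nat.card (Tableau S (n + 1)) =
      ∑ c ∈ S with IsOuter S c, Nat.card (Tableau (S.erase c) n) := by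
  have e : Function.Bijective
      (fun p : (c : {c // c ∈ S.filter (IsOuter S)}) × Tableau (S.erase c.1) n =>
        (⟨extendEquiv p.1.1 (Finset.mem_filter.1 p.1.2).1 p.2.1,
          extendEquiv_mono _ _ (Finset.mem_filter.1 p.1.2).2 p.2⟩ : Tableau S (n + 1))) := by
    constructor
    · rintro ⟨⟨c, hc⟩, T⟩ ⟨⟨d, hd⟩, U⟩ h
      have hc' := (Finset.mem_filter.1 hc).1
      have hd' := (Finset.mem_filter.1 hd).1
      replace h : extendEquiv c hc' T.1 = extendEquiv d hd' U.1 := congrArg Subtype.val h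
      -- The outer box is recovered from the numbering as the position of its largest entry.
      have hcd : (⟨c, hc'⟩ : {b // b ∈ S}) = ⟨d, hd'⟩ := by
        apply (extendEquiv c hc' T.1).injective
        rw [extendEquiv_self, h, extendEquiv_self]
      obtain rfl : c = d := congrArg Subtype.val hcd
      congr 1
      refine Subtype.ext (Equiv.ext fun b => Fin.castSucc_injective _ ?_)
      rw [← extendEquiv_of_ne c hc' T.1 b, h, extendEquiv_of_ne]
    · rintro ⟨T, hT⟩
      obtain ⟨⟨c, hc⟩, hlast⟩ := T.surjective (Fin.last n)
      -- A box preceded by `c` would need an entry larger than the largest one.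
      have ho : IsOuter S c := fun b hb h => by
        have := hT ⟨c, hc⟩ ⟨b, hb⟩ h
        rw [hlast] at this
        exact absurd (Fin.le_last _) (not_le.2 this)
      refine ⟨⟨⟨c, Finset.mem_filter.2 ⟨hc, ho⟩⟩, restrictEquiv c hc T hlast, fun a b h => ?_⟩, ?_⟩
      · rw [← Fin.castSucc_lt_castSucc_iff, castSucc_restrictEquiv, castSucc_restrictEquiv]
        exact hT _ _ h
      · refine Subtype.ext (Equiv.ext fun b => ?_)
        obtain ⟨b, hb⟩ := b
        by_cases hbc : b = c
        · subst hbc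
          exact (extendEquiv_self _ _ _).trans hlast.symm
        · exact (extendEquiv_of_ne c hc _ ⟨b, Finset.mem_erase.2 ⟨hbc, hb⟩⟩).trans
            (castSucc_restrictEquiv c hc T hlast _)
  rw [← Nat.card_congr (Equiv.ofBijective _ e), Nat.card_sigma,
    ← Finset.sum_coe_sort (S.filter (IsOuter S))]

theorem card_tableau_empty : Nat.card (Tableau ∅ 0) = 1 := by
  rw [Nat.card_eq_one_iff_unique]
  refine ⟨⟨fun T U => Subtype.ext (Equiv.ext fun b => (T.1 b).elim0)⟩,
    ⟨Equiv.equivOfIsEmpty _ _, fun a => absurd a.2 (Finset.notMem_empty _)⟩⟩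

/-- Frees the number of entries from the literal cardinality of the shape, so that tableaux can be
counted by induction on it. -/
theorem skewDim_eq_card_tableau {n m : YoungDiagram} {k : ℕ}
    (h : (n.cells \ m.cells).card = k) :
    skewDim n m = Nat.card (Tableau (n.cells \ m.cells) k) := by
  subst h; rfl

/-! ## Determinants of reciprocal factorials -/

noncomputable section

/-- The reciprocal factorial, extended by `0` to the negative integers. -/
def invFact (m : ℤ) : ℂ := if 0 ≤ m then ((m.toNat.factorial : ℂ))⁻¹ else 0

theorem invFact_neg {m : ℤ} (h : m < 0) : invFact m = 0 := if_neg (not_le.2 h)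

theorem invFact_natCast (n : ℕ) : invFact n = ((n.factorial : ℂ))⁻¹ := by simp [invFact]

/-- The extension by zero makes the recurrence of `1/m!` hold at every integer; at `m = 0` the
factor `m` matches `1/(-1)! = 0`. -/
theorem invFact_sub_one (m : ℤ) : invFact (m - 1) = m * invFact m := by
  rcases lt_trichotomy m 0 with h | rfl | h
  · rw [invFact_neg h, invFact_neg (by omega), mul_zero]
  · simp [invFact]
  · obtain ⟨n, rfl⟩ : ∃ n : ℕ, m = n + 1 := ⟨(m - 1).toNat, by omega⟩
    rw [add_sub_cancel_right, invFact_natCast, ← Nat.cast_succ, invFact_natCast,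
      Nat.factorial_succ]
    have h1 : ((n.succ : ℕ) : ℂ) ≠ 0 := Nat.cast_ne_zero.2 n.succ_ne_zero
    have h2 : ((n.factorial : ℕ) : ℂ) ≠ 0 := Nat.cast_ne_zero.2 n.factorial_ne_zero
    push_cast at h1 ⊢
    field_simp

/-- `det[1 / (b_j - a_i)!]` of size `N`. -/
def factDet (N : ℕ) (a b : ℕ → ℤ) : ℂ :=
  (Matrix.of fun i j : Fin N => invFact (b j - a i)).det

/-- In the Leibniz expansion, lowering `b j` multiplies the term of `σ` by `b j - a (σ j)`, by
`invFact_sub_one`. Summed over `j`, these multipliers give `∑ b - ∑ a`, which does not depend on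
`σ`. For diagrams this becomes the branching rule. -/
theorem sum_factDet_update (N : ℕ) (a b : ℕ → ℤ) :
    ∑ j ∈ Finset.range N, factDet N a (Function.update b j (b j - 1)) =
      ((∑ j ∈ Finset.range N, b j - ∑ j ∈ Finset.range N, a j : ℤ) : ℂ) * factDet N a b := by
  rw [← Fin.sum_univ_eq_sum_range (fun j => factDet N a (Function.update b j (b j - 1)))]
  simp only [factDet, Matrix.det_apply', Matrix.of_apply]
  rw [Finset.sum_comm, Finset.mul_sum]
  refine Finset.sum_congr rfl fun σ _ => ?_
  rw [← Finset.mul_sum, mul_left_comm]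
  congr 1
  have h : ∀ j : Fin N, ∏ i : Fin N, invFact (Function.update b (j : ℕ) (b j - 1) i - a (σ i)) =
      ((b j - a (σ j) : ℤ) : ℂ) * ∏ i : Fin N, invFact (b i - a (σ i)) := by
    intro j
    rw [← Finset.mul_prod_erase _ _ (Finset.mem_univ j),
      ← Finset.mul_prod_erase _ (fun i : Fin N => invFact (b i - a (σ i))) (Finset.mem_univ j),
      Function.update_self, sub_right_comm, invFact_sub_one, mul_assoc]
    congr 2
    refine Finset.prod_congr rfl fun i hi => ?_
    rw [Function.update_of_ne]
    exact fun h => (Finset.mem_erase.1 hi).1 (Fin.ext h)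
  rw [Finset.sum_congr rfl fun j _ => h j, ← Finset.sum_mul, ← Int.cast_sum,
    Finset.sum_sub_distrib, Fin.sum_univ_eq_sum_range (fun j => b j),
    Equiv.sum_comp σ (fun j : Fin N => a j), Fin.sum_univ_eq_sum_range (fun j => a j)]

/-- The entries in rows `≤ i` and columns `≥ i` are reciprocal factorials of negative integers. This
zero block has `i + 1` rows and `N - i` columns, too many for a permutation to avoid. -/
theorem factDet_eq_zero_of_lt {N : ℕ} {a b : ℕ → ℤ} {i : ℕ} (hi : i < N)
    (ha : ∀ k ≤ i, a i ≤ a k) (hb : ∀ k, i ≤ k → b k ≤ b i) (h : b i < a i) :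
    factDet N a b = 0 := by
  rw [factDet, Matrix.det_apply']
  refine Finset.sum_eq_zero fun σ _ => ?_
  -- Pigeonhole: `σ` cannot inject the `N - i` columns from `i` on into the `N - i - 1` rows after
  -- `i`.
  obtain ⟨j, hij, hj⟩ : ∃ j : Fin N, i ≤ j ∧ (σ j : ℕ) ≤ i := by
    by_contra! hcon
    have hsub : (Finset.Ici (⟨i, hi⟩ : Fin N)).image σ ⊆ Finset.Ioi ⟨i, hi⟩ := by
      intro k hk
      obtain ⟨j, hj, rfl⟩ := Finset.mem_image.1 hk
      rw [Finset.mem_Ici, Fin.le_def] at hj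
      rw [Finset.mem_Ioi, Fin.lt_def]
      exact hcon j hj
    have := Finset.card_le_card hsub
    rw [Finset.card_image_of_injective _ σ.injective, Fin.card_Ici, Fin.card_Ioi] at this
    simp only at this
    omega
  rw [Finset.prod_eq_zero (Finset.mem_univ j), mul_zero]
  rw [Matrix.of_apply, invFact_neg]
  have := ha _ hj
  have := hb _ hij
  omega

theorem factDet_eq_zero_of_eq {N : ℕ} {a b : ℕ → ℤ} {i j : ℕ} (hi : i < N) (hj : j < N)
    (hij : i ≠ j) (h : b i = b j) : factDet N a b = 0 := by
  refine Matrix.det_zero_of_column_eq (i := ⟨i, hi⟩) (j := ⟨j, hj⟩) (by simpa using hij) ?_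
  intro k
  simp [h]

theorem factDet_self {N : ℕ} {a : ℕ → ℤ} (ha : StrictAnti a) : factDet N a a = 1 := by
  rw [factDet, Matrix.det_of_isLowerTriangular]
  · simp [invFact]
  · intro i j hij
    rw [Matrix.of_apply, invFact_neg]
    exact sub_neg.2 (ha (by simpa using hij))

end

end MeixnerSym
namespace MeixnerSym

noncomputable section

/-! ## The dimension of a skew diagram as a determinant -/

/-- The shifted row lengths `l_i + N - 1 - i`. -/
def shifted (N : ℕ) (l : YoungDiagram) (i : ℕ) : ℤ := l.rowLen i + N - 1 - i

theorem shifted_strictAnti (N : ℕ) (l : YoungDiagram) : StrictAnti (shifted N l) := by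
  intro i j hij
  have := l.rowLen_anti i j hij.le
  simp only [shifted]
  omega

theorem colLen_le_of_le {m n : YoungDiagram} (h : m ≤ n) (i : ℕ) : m.colLen i ≤ n.colLen i := by
  by_contra! hlt
  exact absurd (YoungDiagram.mem_iff_lt_colLen.1 (h (YoungDiagram.mem_iff_lt_colLen.2 hlt)))
    (lt_irrefl _)

theorem lt_of_rowLen_pos {l : YoungDiagram} {N i : ℕ} (hN : l.colLen 0 ≤ N)
    (h : 0 < l.rowLen i) : i < N := by
  by_contra! hi
  exact h.ne' (rowLen_eq_zero (hN.trans hi))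

theorem sum_rowLen {l : YoungDiagram} {N : ℕ} (hN : l.colLen 0 ≤ N) :
    ∑ i ∈ Finset.range N, l.rowLen i = l.card := by
  rw [YoungDiagram.card, Finset.card_eq_sum_card_fiberwise (f := Prod.fst) (t := Finset.range N)]
  · exact Finset.sum_congr rfl fun i _ => l.rowLen_eq_card
  · rintro ⟨i, j⟩ h
    rw [Finset.mem_coe, YoungDiagram.mem_cells, YoungDiagram.mem_iff_lt_rowLen] at h
    exact Finset.mem_coe.2 (Finset.mem_range.2 (lt_of_rowLen_pos hN (Nat.zero_lt_of_lt h)))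

theorem sum_shifted_sub {l m : YoungDiagram} {N : ℕ} (hl : l.colLen 0 ≤ N)
    (hm : m.colLen 0 ≤ N) :
    ∑ i ∈ Finset.range N, shifted N l i - ∑ i ∈ Finset.range N, shifted N m i =
      l.card - m.card := by
  rw [← sum_rowLen hl, ← sum_rowLen hm, ← Finset.sum_sub_distrib]
  push_cast
  rw [← Finset.sum_sub_distrib]
  exact Finset.sum_congr rfl fun i _ => by simp only [shifted]; ring

theorem factDet_eq_zero_of_not_le {l m : YoungDiagram} {N : ℕ} (hm : m.colLen 0 ≤ N)
    (h : ¬ m ≤ l) : factDet N (shifted N m) (shifted N l) = 0 := by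
  obtain ⟨⟨i, k⟩, hk, hkl⟩ := Set.not_subset.1 h
  have hk := YoungDiagram.mem_iff_lt_rowLen.1 hk
  have hkl : ¬ k < l.rowLen i := fun h => hkl (YoungDiagram.mem_iff_lt_rowLen.2 h)
  refine factDet_eq_zero_of_lt (lt_of_rowLen_pos hm (Nat.zero_lt_of_lt hk))
    (fun k hk => (shifted_strictAnti N m).antitone hk)
    (fun k hk => (shifted_strictAnti N l).antitone hk) ?_
  simp only [shifted]
  omega

/-- Removal of an outer box from a diagram. -/
def removeBox (l : YoungDiagram) (c : ℕ × ℕ) (hc : IsOuter l.cells c) : YoungDiagram where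
  cells := l.cells.erase c
  isLowerSet := by
    rintro ⟨i, j⟩ ⟨i', j'⟩ ⟨hi, hj⟩ h
    simp only at hi hj
    rw [Finset.mem_coe, Finset.mem_erase] at h ⊢
    refine ⟨?_, l.up_left_mem hi hj h.2⟩
    rintro rfl
    rcases hj.lt_or_eq with hlt | rfl
    · exact hc (i', j) (l.up_left_mem hi le_rfl h.2) (Or.inl ⟨rfl, hlt⟩)
    · rcases hi.lt_or_eq with hlt | rfl
      · exact hc (i, j') h.2 (Or.inr ⟨rfl, hlt⟩)
      · exact h.1 rfl

theorem mem_removeBox {l : YoungDiagram} {c : ℕ × ℕ} {hc : IsOuter l.cells c} {b : ℕ × ℕ} :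
    b ∈ removeBox l c hc ↔ b ≠ c ∧ b ∈ l := Finset.mem_erase

theorem IsOuter.rowLen_eq {l : YoungDiagram} {c : ℕ × ℕ} (hc : IsOuter l.cells c) (hl : c ∈ l) :
    l.rowLen c.1 = c.2 + 1 := by
  refine le_antisymm ?_ (YoungDiagram.mem_iff_lt_rowLen.1 hl)
  by_contra! h
  exact hc (c.1, c.2 + 1) (YoungDiagram.mem_iff_lt_rowLen.2 h) (Or.inl ⟨rfl, Nat.lt_succ_self _⟩)

theorem rowLen_removeBox {l : YoungDiagram} {c : ℕ × ℕ} (hc : IsOuter l.cells c) (hl : c ∈ l)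
    (i : ℕ) : (removeBox l c hc).rowLen i = if i = c.1 then c.2 else l.rowLen i := by
  refine eq_of_forall_lt_iff fun k => ?_
  have h1 := hc.rowLen_eq hl
  rw [← YoungDiagram.mem_iff_lt_rowLen, mem_removeBox, YoungDiagram.mem_iff_lt_rowLen, Ne,
    Prod.ext_iff]
  split_ifs with h
  · subst h
    simp only [true_and]
    omega
  · simp [h]

/-- A box that `c` precedes cannot lie in `m`, for then `c` would too; deleting `m` therefore
removes no obstruction. -/
theorem isOuter_sdiff_iff {l m : YoungDiagram} {c : ℕ × ℕ} (hc : c ∉ m) :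
    IsOuter (l.cells \ m.cells) c ↔ IsOuter l.cells c := by
  refine ⟨fun h b hb hcb => h b (Finset.mem_sdiff.2 ⟨hb, fun hbm => hc ?_⟩) hcb,
    fun h b hb => h b (Finset.mem_sdiff.1 hb).1⟩
  rcases hcb with ⟨h1, h2⟩ | ⟨h1, h2⟩
  · exact m.up_left_mem h1.le h2.le hbm
  · exact m.up_left_mem h2.le h1.le hbm

theorem shifted_removeBox {l : YoungDiagram} {c : ℕ × ℕ} (hc : IsOuter l.cells c) (hl : c ∈ l)
    (N : ℕ) : shifted N (removeBox l c hc) =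
      Function.update (shifted N l) c.1 (shifted N l c.1 - 1) := by
  funext i
  by_cases h : i = c.1
  · subst h
    rw [Function.update_self, shifted, rowLen_removeBox hc hl, if_pos rfl, shifted,
      hc.rowLen_eq hl]
    push_cast; ring
  · rw [Function.update_of_ne h, shifted, rowLen_removeBox hc hl, if_neg h, shifted]

/-- Rows without a removable box outside `m` contribute nothing to the branching sum. If row `j` of
`l` is no longer than that of `m`, lowering it creates the zero block of `factDet_eq_zero_of_lt`.
Otherwise row `j + 1` must be as long as row `j`, and lowering makes two columns equal. -/
theorem factDet_update_eq_zero {l m : YoungDiagram} {N : ℕ} (hl : l.colLen 0 ≤ N) {j : ℕ}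
    (hj : j < N) (h : ∀ k, (j, k) ∈ l → (j, k) ∉ m → ¬ IsOuter l.cells (j, k)) :
    factDet N (shifted N m) (Function.update (shifted N l) j (shifted N l j - 1)) = 0 := by
  by_cases hlt : l.rowLen j ≤ m.rowLen j
  · refine factDet_eq_zero_of_lt hj (fun k hk => (shifted_strictAnti N m).antitone hk)
      (fun k hk => ?_) ?_
    · rcases hk.eq_or_lt with rfl | hk
      · exact le_rfl
      · rw [Function.update_of_ne hk.ne', Function.update_self]
        exact Int.le_sub_one_of_lt (shifted_strictAnti N l hk)
    · rw [Function.update_self]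
      simp only [shifted]
      omega
  · push Not at hlt
    have h1 := h (l.rowLen j - 1) (YoungDiagram.mem_iff_lt_rowLen.2 (by omega))
      (fun h' => by have := YoungDiagram.mem_iff_lt_rowLen.1 h'; omega)
    -- If row `j + 1` were shorter, the last box of row `j` would be outer.
    have h2 : l.rowLen (j + 1) = l.rowLen j := by
      refine le_antisymm (l.rowLen_anti _ _ (Nat.le_succ j)) ?_
      by_contra! hgt
      refine h1 ?_
      rintro ⟨i, k⟩ hb (⟨rfl, hk⟩ | ⟨hk, hi⟩)
      · have := YoungDiagram.mem_iff_lt_rowLen.1 hb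
        simp only at hk this
        omega
      · have := YoungDiagram.mem_iff_lt_rowLen.1 hb
        have := l.rowLen_anti (j + 1) i hi
        simp only at hk
        omega
    refine factDet_eq_zero_of_eq hj (lt_of_rowLen_pos hl (i := j + 1) (by omega))
      (Nat.lt_succ_self j).ne ?_
    rw [Function.update_self, Function.update_of_ne (Nat.succ_ne_self j)]
    simp only [shifted, h2]
    push_cast; ring

/-- Aitken's determinantal formula for the number of standard tableaux of a skew shape. -/
theorem factorial_mul_factDet {m : YoungDiagram} {N : ℕ} (hm : m.colLen 0 ≤ N) (n : ℕ) :
    ∀ l : YoungDiagram, m ≤ l → l.colLen 0 ≤ N → l.card = m.card + n →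
      (n.factorial : ℂ) * factDet N (shifted N m) (shifted N l) =
        Nat.card (Tableau (l.cells \ m.cells) n) := by
  classical
  induction n with
  | zero =>
    intro l hml hl hcard
    obtain rfl : m = l :=
      YoungDiagram.ext (Finset.eq_of_subset_of_card_le (YoungDiagram.cells_subset_iff.2 hml)
        (by simpa using hcard.le))
    rw [Finset.sdiff_self, card_tableau_empty, factDet_self (shifted_strictAnti N m)]
    simp
  | succ n ih =>
    intro l hml hl hcard
    -- The factor `∑ b - ∑ a` is `|l| - |m| = n + 1`, exactly what turns `n!` into `(n + 1)!`.
    have hsum := sum_factDet_update N (shifted N m) (shifted N l)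
    rw [sum_shifted_sub hl hm, hcard] at hsum
    push_cast at hsum
    rw [add_sub_cancel_left] at hsum
    rw [Nat.factorial_succ, Nat.cast_mul, Nat.cast_succ, mul_comm ((n : ℂ) + 1), mul_assoc,
      ← hsum, Finset.mul_sum, card_tableau_succ, Nat.cast_sum]
    symm
    have key : ∀ c ∈ (l.cells \ m.cells).filter (IsOuter (l.cells \ m.cells)),
        c ∈ l ∧ c ∉ m ∧ IsOuter l.cells c := by
      intro c hc
      rw [Finset.mem_filter, Finset.mem_sdiff] at hc
      exact ⟨hc.1.1, hc.1.2, (isOuter_sdiff_iff hc.1.2).1 hc.2⟩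
    -- Outer boxes are matched with their rows: a row has at most one, namely its last box, and the
    -- rows that have none in `l/m` give zero determinants.
    refine Finset.sum_of_injOn Prod.fst ?_ ?_ ?_ ?_
    · intro c hc d hd hcd
      obtain ⟨hc1, -, hc3⟩ := key c hc
      obtain ⟨hd1, -, hd3⟩ := key d hd
      have h1 := hc3.rowLen_eq hc1
      have h2 := hd3.rowLen_eq hd1
      rw [hcd] at h1
      exact Prod.ext hcd (by omega)
    · intro c hc
      obtain ⟨hc1, -, hc3⟩ := key c hc
      have h1 := hc3.rowLen_eq hc1
      exact Finset.mem_coe.2 (Finset.mem_range.2 (lt_of_rowLen_pos hl (by omega)))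
    · intro j hj hj'
      rw [factDet_update_eq_zero hl (Finset.mem_range.1 hj), mul_zero]
      intro k hk hkm ho
      refine hj' ⟨(j, k), ?_, rfl⟩
      rw [Finset.mem_coe, Finset.mem_filter, Finset.mem_sdiff]
      exact ⟨⟨hk, hkm⟩, (isOuter_sdiff_iff hkm).2 ho⟩
    · intro c hc
      obtain ⟨hc1, hc2, hc3⟩ := key c hc
      have hle : removeBox l c hc3 ≤ l := fun b hb => (mem_removeBox.1 hb).2
      rw [← shifted_removeBox hc3 hc1, ih (removeBox l c hc3)]
      · rw [← Finset.erase_sdiff_comm]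
        rfl
      · intro b hb
        refine mem_removeBox.2 ⟨?_, hml hb⟩
        rintro rfl
        exact hc2 hb
      · exact (colLen_le_of_le hle 0).trans hl
      · have : (l.cells.erase c).card + 1 = l.card := Finset.card_erase_add_one hc1
        change (l.cells.erase c).card = _
        omega

theorem factDet_eq_skewDim {l m : YoungDiagram} {N : ℕ} (hm : m.colLen 0 ≤ N)
    (hl : l.colLen 0 ≤ N) (h : m ≤ l) :
    factDet N (shifted N m) (shifted N l) =
      skewDim l m / ((l.card - m.card).factorial : ℂ) := by
  have hsub := YoungDiagram.cells_subset_iff.2 h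
  have hcard : m.card ≤ l.card := Finset.card_le_card hsub
  have h0 : ((l.card - m.card).factorial : ℂ) ≠ 0 := Nat.cast_ne_zero.2 (Nat.factorial_ne_zero _)
  rw [eq_div_iff h0, mul_comm, factorial_mul_factDet hm _ l h hl (by omega),
    skewDim_eq_card_tableau (Finset.card_sdiff_of_subset hsub)]

theorem shifted_eq {N : ℕ} (l : YoungDiagram) (i : Fin N) :
    shifted N l i = ((l.rowLen i + (N - 1 - i) : ℕ) : ℤ) := by
  have := i.2
  simp only [shifted]
  omega

theorem descPochhammer_eval_natCast (k x : ℕ) :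
    (descPochhammer ℂ k).eval (x : ℂ) = x.factorial * invFact (x - k) := by
  rw [descPochhammer_eval_eq_descFactorial]
  rcases le_or_gt k x with h | h
  · rw [← Nat.cast_sub h, invFact_natCast, ← div_eq_mul_inv, Nat.descFactorial_eq_div h,
      Nat.cast_div (Nat.factorial_dvd_factorial (Nat.sub_le x k))
        (Nat.cast_ne_zero.2 (Nat.factorial_ne_zero _))]
  · rw [Nat.descFactorial_of_lt h, invFact_neg (by omega)]
    simp

/-- With `x_j = l_j + N - 1 - j`, column `j` has the common factor `x_j!`, which does not depend on
`m` and so cancels in `factorialSchur_point`. -/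
theorem det_descPochhammer (N : ℕ) (m l : YoungDiagram) :
    (Matrix.of fun i j : Fin N =>
        (descPochhammer ℂ (m.rowLen i + (N - 1 - i))).eval (point N l j)).det =
      (∏ j : Fin N, ((l.rowLen j + (N - 1 - j)).factorial : ℂ)) *
        factDet N (shifted N m) (shifted N l) := by
  rw [factDet, ← Matrix.det_mul_row]
  congr 1
  ext i j
  simp only [Matrix.of_apply, point, descPochhammer_eval_natCast, shifted_eq]

theorem rowLen_bot (i : ℕ) : (⊥ : YoungDiagram).rowLen i = 0 := by
  by_contra h
  exact YoungDiagram.notMem_bot (i, 0) (YoungDiagram.mem_iff_lt_rowLen.2 (Nat.pos_of_ne_zero h))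

theorem colLen_bot (i : ℕ) : (⊥ : YoungDiagram).colLen i = 0 := by
  by_contra h
  exact YoungDiagram.notMem_bot (0, i) (YoungDiagram.mem_iff_lt_colLen.2 (Nat.pos_of_ne_zero h))

/-- The Vandermonde denominator is the numerator determinant of the empty diagram. -/
theorem prod_sub_eq (N : ℕ) (l : YoungDiagram) :
    ∏ i, ∏ j ∈ Finset.Ioi i, (point N l i - point N l j) =
      (∏ j : Fin N, ((l.rowLen j + (N - 1 - j)).factorial : ℂ)) *
        factDet N (shifted N ⊥) (shifted N l) := by
  rw [← det_fall, ← det_descPochhammer]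
  simp only [fall, rowLen_bot, zero_add]

theorem factDet_bot_ne_zero (N : ℕ) (l : YoungDiagram) :
    factDet N (shifted N ⊥) (shifted N l) ≠ 0 := by
  have h := vand_ne_zero l N
  rw [prod_sub_eq] at h
  exact right_ne_zero_of_mul h

theorem factDet_bot_eq {l : YoungDiagram} {N : ℕ} (hl : l.colLen 0 ≤ N) :
    factDet N (shifted N ⊥) (shifted N l) = dim l / (l.card.factorial : ℂ) := by
  rw [factDet_eq_skewDim (by simp [colLen_bot]) hl bot_le, dim]
  simp [YoungDiagram.card]

/-- Follows from the Vandermonde product at distinct points, with no tableau to construct. -/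
theorem dim_ne_zero (l : YoungDiagram) : (dim l : ℂ) ≠ 0 := by
  have h := factDet_bot_ne_zero (l.colLen 0) l
  rw [factDet_bot_eq le_rfl] at h
  exact (div_ne_zero_iff.1 h).1

theorem factorialSchur_point (N : ℕ) (m l : YoungDiagram) :
    factorialSchur m N (point N l) =
      factDet N (shifted N m) (shifted N l) / factDet N (shifted N ⊥) (shifted N l) := by
  rw [factorialSchur, det_descPochhammer, prod_sub_eq, mul_div_mul_left]
  exact Finset.prod_ne_zero_iff.2 fun j _ => Nat.cast_ne_zero.2 (Nat.factorial_ne_zero _)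

/-- The vanishing property of the Frobenius-Schur functions. -/
theorem value_frobeniusSchur_of_not_le {m l : YoungDiagram} (h : ¬ m ≤ l) :
    value (frobeniusSchur m) l = 0 := by
  rw [value_frobeniusSchur m l _ (le_max_left _ (l.colLen 0)) (le_max_right _ _),
    factorialSchur_point, factDet_eq_zero_of_not_le (le_max_left _ _) h, zero_div]

/-- The values of the Frobenius-Schur functions are relative dimensions. -/
theorem value_frobeniusSchur_of_le {m l : YoungDiagram} (h : m ≤ l) :
    value (frobeniusSchur m) l =
      (skewDim l m / ((l.card - m.card).factorial : ℂ)) / (dim l / (l.card.factorial : ℂ)) := by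
  rw [value_frobeniusSchur m l _ (le_max_left _ (l.colLen 0)) (le_max_right _ _),
    factorialSchur_point, factDet_bot_eq (le_max_right _ _),
    factDet_eq_skewDim (le_max_left _ _) (le_max_right _ _) h]

/-! ## Autoduality -/

theorem mem_subdiagrams {m n : YoungDiagram} : m ∈ subdiagrams n ↔ m ≤ n := by
  simp [subdiagrams]

theorem value_meixner (z z' ξ : ℂ) (n l : YoungDiagram) :
    value (meixner z z' ξ n) l = ∑ m ∈ subdiagrams n,
      ((-1) ^ (n.card - m.card) * (ξ / (1 - ξ)) ^ (n.card - m.card) *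
        ((skewDim n m : ℂ) / ((n.card - m.card).factorial : ℂ)) * contentProd z z' n m) *
          value (frobeniusSchur m) l := by
  simp [value, meixner, MvPolynomial.smul_eval]

theorem contentProd_mul (z z' : ℂ) {n m : YoungDiagram} (h : m ≤ n) :
    contentProd z z' n m * contentProd z z' m ⊥ = contentProd z z' n ⊥ := by
  simpa [contentProd] using Finset.prod_sdiff (YoungDiagram.cells_subset_iff.2 h)
    (f := fun b => (z + content b) * (z' + content b))

theorem contentProd_bot_ne_zero {z z' : ℂ} {n : YoungDiagram}
    (h : ∀ b ∈ n.cells, (z + content b) * (z' + content b) ≠ 0) : contentProd z z' n ⊥ ≠ 0 :=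
  Finset.prod_ne_zero_iff.2 fun b hb => h b (Finset.mem_sdiff.1 hb).1

theorem normFactor_ne_zero {z z' ξ : ℂ} (hξ0 : ξ ≠ 0) (hξ1 : ξ ≠ 1) {n : YoungDiagram}
    (h : ∀ b ∈ n.cells, (z + content b) * (z' + content b) ≠ 0) : normFactor z z' ξ n ≠ 0 :=
  mul_ne_zero (mul_ne_zero (pow_ne_zero _ (div_ne_zero hξ0 (sub_ne_zero.2 hξ1)))
    (div_ne_zero (dim_ne_zero n) (Nat.cast_ne_zero.2 (Nat.factorial_ne_zero _))))
    (contentProd_bot_ne_zero h)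

/-- The symmetric kernel form of the normalized Meixner functions. -/
theorem value_meixnerNormalized {z z' ξ : ℂ} (hξ0 : ξ ≠ 0) (hξ1 : ξ ≠ 1) {n : YoungDiagram}
    (l : YoungDiagram) (h : ∀ b ∈ n.cells, (z + content b) * (z' + content b) ≠ 0) :
    value (meixnerNormalized z z' ξ n) l = ∑ m ∈ subdiagrams (n ⊓ l),
      ((ξ / (ξ - 1)) ^ m.card * contentProd z z' m ⊥)⁻¹ *
        (value (frobeniusSchur m) n * value (frobeniusSchur m) l) := by
  have e : value (meixnerNormalized z z' ξ n) l =
      (normFactor z z' ξ n)⁻¹ * value (meixner z z' ξ n) l := by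
    simp [value, meixnerNormalized, MvPolynomial.smul_eval]
  rw [e, value_meixner, Finset.mul_sum]
  symm
  classical
  -- Diagrams `m ≤ n` not contained in `l` drop out because `FS_m` vanishes at `l`.
  refine Finset.sum_subset_zero_on_sdiff
    (fun m hm => mem_subdiagrams.2 ((mem_subdiagrams.1 hm).trans inf_le_left))
    (fun m hm => ?_) fun m hm => ?_
  · rw [Finset.mem_sdiff, mem_subdiagrams, mem_subdiagrams] at hm
    rw [value_frobeniusSchur_of_not_le fun h' => hm.2 (le_inf hm.1 h')]
    simp
  · have hmn := (mem_subdiagrams.1 hm).trans inf_le_left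
    have hcard : m.card ≤ n.card := Finset.card_le_card (YoungDiagram.cells_subset_iff.2 hmn)
    have hC := contentProd_bot_ne_zero h
    rw [← contentProd_mul z z' hmn] at hC
    have hC1 := left_ne_zero_of_mul hC
    have hC2 := right_ne_zero_of_mul hC
    have hq : ξ / (ξ - 1) ≠ 0 := div_ne_zero hξ0 (sub_ne_zero.2 hξ1)
    -- The alternating sign turns `ξ / (1 - ξ)` into the `ξ / (ξ - 1)` of the normalizing factor.
    have hs : (-1 : ℂ) ^ (n.card - m.card) * (ξ / (1 - ξ)) ^ (n.card - m.card) =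
        (ξ / (ξ - 1)) ^ (n.card - m.card) := by
      rw [← mul_pow, neg_one_mul, ← div_neg, neg_sub]
    have hp : (ξ / (ξ - 1)) ^ n.card =
        (ξ / (ξ - 1)) ^ (n.card - m.card) * (ξ / (ξ - 1)) ^ m.card := by
      rw [← pow_add, Nat.sub_add_cancel hcard]
    -- Everything attached to `n/m` now occurs on both sides or cancels against `normFactor`; the
    -- powers of `q` are made atoms before clearing denominators.
    rw [value_frobeniusSchur_of_le hmn, hs, normFactor, hp, ← contentProd_mul z z' hmn]
    generalize ξ / (ξ - 1) = q at *
    have hq1 := pow_ne_zero (n.card - m.card) hq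
    have hq2 := pow_ne_zero m.card hq
    have hd := dim_ne_zero n
    have hf : (n.card.factorial : ℂ) ≠ 0 := Nat.cast_ne_zero.2 (Nat.factorial_ne_zero _)
    generalize q ^ (n.card - m.card) = q1 at *
    generalize q ^ m.card = q2 at *
    field_simp

end

end MeixnerSym

theorem mainTheorem12 (z z' ξ : ℂ) (hξ0 : ξ ≠ 0) (hξ1 : ξ ≠ 1) (ν l : YoungDiagram)
    (hν : ∀ b ∈ ν.cells, (z + MeixnerSym.content b) * (z' + MeixnerSym.content b) ≠ 0)
    (hl : ∀ b ∈ l.cells, (z + MeixnerSym.content b) * (z' + MeixnerSym.content b) ≠ 0) :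
    MeixnerSym.meixner z z' ξ ν =
        MeixnerSym.normFactor z z' ξ ν • MeixnerSym.meixnerNormalized z z' ξ ν ∧
      MeixnerSym.value (MeixnerSym.meixnerNormalized z z' ξ ν) l =
        MeixnerSym.value (MeixnerSym.meixnerNormalized z z' ξ l) ν := by
  refine ⟨?_, ?_⟩
  · rw [MeixnerSym.meixnerNormalized,
      smul_inv_smul₀ (MeixnerSym.normFactor_ne_zero hξ0 hξ1 hν)]
  -- The expansion is applied once with index `ν` and once with index `l`; the two sums agree term
  -- by term.
  · rw [MeixnerSym.value_meixnerNormalized hξ0 hξ1 l hν,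
      MeixnerSym.value_meixnerNormalized hξ0 hξ1 ν hl, inf_comm]
    exact Finset.sum_congr rfl fun m _ => by rw [mul_comm (MeixnerSym.value _ ν)]
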